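/- Let $d\in\mathbb N$, $Y=[0,1]^d$, and let $\mathcal L:Y\to\mathbb R$ be the underlying map. \emph{Discrepancy.} For points $y_1,\dots,y_N\in Y$, $N\ge 1$, put $$D_N^*=\sup_{z\in Y}\Bigl|\tfrac1N\#\{n: y_n\in[0,z]\}-\mathrm{meas}([0,z])\Bigr|,\qquad [0,z]=\prod_{i=1}^d[0,z_i].$$ The points form a low-discrepancy sequence with constant $C$ if $D_N^*\le C\,(\log N)^d/N$; the constant $C$ may depend on $d$ but not on $N$. \emph{Variation.} Let $[a,b]=\prod_j[a_j,b_j]$ be a hyperrectangle. A ladder $\mathcal Y=\prod_j\mathcal Y^j$ on $[a,b]$ is given, for each coordinate $j$, by a finite set $\mathcal Y^j$ consisting of $a_j$ and of finitely many (possibly zero) points of $(a_j,b_j)$; the successor $t_+$ of $t\in\mathcal Y^j$ is the smallest element of $\mathcal Y^j$ larger than $t$, or $b_j$ if there is none, and $\mathbf y_+=((y_j)_+)_j$. For a set $v$ of coordinates, $\mathbf y^v:\mathbf y_+^{-v}$ is the vector with coordinates $y_i$ for $i\in v$ and $(y_+)_i$ for $i\notin v$. The Vitali variation is $$V_{[a,b]}(f)=\sup_{\mathcal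 Y}\sum_{\mathbf y\in\mathcal Y}\Bigl|\sum_{v}(-1)^{|v|}f(\mathbf y^v:\mathbf y_+^{-v})\Bigr|\in[0,\infty],$$ the inner sum being over all sets $v$ of coordinates. The Hardy--Krause variation on $Y$ (that is, $a=(0,\dots,0)$, $b=(1,\dots,1)$) is $$V_{HK}(f)=\sum_{u\subsetneq\{1,\dots,d\}}V_{[a^{-u},b^{-u}]}\bigl(f(\,\cdot^{-u}:b^u)\bigr)\in[0,\infty],$$ where $f(\,\cdot^{-u}:b^u)$ is $f$ as a function of the coordinates outside $u$, those in $u$ being fixed at the value $1$. \emph{Network.} Let $\sigma:\mathbb R\to\mathbb R$ be an activation function (applied componentwise), $K>1$, $d_1=d$, $d_{K+1}=1$, let $d_2,\dots,d_K$ be arbitrary widths, $W_k\in\mathbb R^{d_{k+1}\times d_k}$, $b_k\in\mathbb R^{d_{k+1}}$, $C_kz=W_kz+b_k$, and let $$\mathcal L^*=C_K\circ\sigma\circ C_{K-1}\circ\cdots\circ\sigma\circ C_1$$ be the neural network with weights $\theta^*=(W_k,b_k)_{1\le k\le K}$; these may be arbitrary, in particular they may be the weights obtained by training on $\{y_n\}$.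 \textbf{Lemma.} If $y_1,\dots,y_N\in Y$ is a low-discrepancy sequence with constant $C$, then the generalization error $\mathcal E_G=\int_Y|\mathcal L(y)-\mathcal L^*(y)|\,dy$ and the training error $\mathcal E_T=\frac1N\sum_{n=1}^N|\mathcal L(y_n)-\mathcal L^*(y_n)|$ satisfy, with the same constant $C$, $$|\mathcal E_G-\mathcal E_T|\le C\,\frac{V_{HK}(|\mathcal L-\mathcal L^*|)\,(\log N)^d}{N}.$$ (If $V_{HK}(|\mathcal L-\mathcal L^*|)=\infty$ the right-hand side is $\infty$.) -/

import Mathlib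

open MeasureTheory
open scoped ENNReal

noncomputable section

/-- The unit cube `Y = [0,1]^d`. -/
def unitCube (d : ℕ) : Set (Fin d → ℝ) := Set.Icc 0 1

/-! ### Discrepancy -/

/-- `R_N(J) = (1/N) #{n : y_n ∈ J} - meas(J)` (points counted with multiplicity). -/
def localDiscrepancy {d N : ℕ} (y : Fin N → Fin d → ℝ) (J : Set (Fin d → ℝ)) : ℝ :=
  ((Set.ncard {n : Fin N | y n ∈ J} : ℕ) : ℝ) / (N : ℝ) - (volume J).toReal

/-- The rectangular sets with one vertex at `0` and the opposite vertex `z` in the unit cube. -/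
def anchoredBoxes (d : ℕ) : Set (Set (Fin d → ℝ)) :=
  {J | ∃ z ∈ unitCube d, J = Set.Icc 0 z}

/-- The star discrepancy `D*_N = sup_J |R_N(J)|`; the supremum is over a nonempty set of reals
that is bounded above by `1`. -/
def starDiscrepancy {d N : ℕ} (y : Fin N → Fin d → ℝ) : ℝ :=
  sSup ((fun J => |localDiscrepancy y J|) '' anchoredBoxes d)

/-- `y_1, …, y_N` are points of the unit cube with `D*_N ≤ C (log N)^d / N`. -/
def IsLowDiscrepancy {d N : ℕ} (C : ℝ) (y : Fin N → Fin d → ℝ) : Prop :=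
  (∀ n, y n ∈ unitCube d) ∧
    starDiscrepancy y ≤ C * (Real.log (N : ℝ)) ^ d / (N : ℝ)

/-! ### Variation in the sense of Vitali and of Hardy and Krause -/

/-- The successor of `t` in the finite set `S`: the smallest element of `S` above `t` if there
is one, and `b` otherwise. -/
def ladderSucc (S : Finset ℝ) (b t : ℝ) : ℝ :=
  if h : (S.filter (fun s => t < s)).Nonempty then (S.filter (fun s => t < s)).min' h else b

/-- A ladder on `[a,b]`: in each coordinate `j` a finite set consisting of `a j` and of finitely
many (possibly zero) values in the open interval `(a j, b j)`. -/
structure Ladder {ι : Type} (a b : ι → ℝ) where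
  /-- the values strictly between the endpoints -/
  inner : ι → Finset ℝ
  inner_mem : ∀ j, ∀ t ∈ inner j, t ∈ Set.Ioo (a j) (b j)

/-- All the values of the ladder in coordinate `j`. -/
def Ladder.values {ι : Type} {a b : ι → ℝ} (P : Ladder a b) (j : ι) : Finset ℝ :=
  insert (a j) (P.inner j)

/-- The glued vector `x^v : z^{-v}`: the coordinates in `v` from `x`, the others from `z`. -/
def glue {ι : Type} [DecidableEq ι] (v : Finset ι) (x z : ι → ℝ) : ι → ℝ :=
  fun i => if i ∈ v then x i else z i

/-- The alternating sum `∑_v (-1)^|v| f(x^v : z^{-v})` over the vertices of the box `[x,z]`. -/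
def boxDifference {ι : Type} [Fintype ι] [DecidableEq ι] (f : (ι → ℝ) → ℝ) (x z : ι → ℝ) : ℝ :=
  ∑ v : Finset ι, (-1 : ℝ) ^ v.card * f (glue v x z)

/-- The variation of `f` over the ladder `P`: the sum of the absolute values of the alternating
sums over all the cells `[y, y₊]` of the ladder. -/
def Ladder.variation {ι : Type} [Fintype ι] [DecidableEq ι] {a b : ι → ℝ} (P : Ladder a b)
    (f : (ι → ℝ) → ℝ) : ℝ :=
  ∑ y ∈ Fintype.piFinset P.values,
    |boxDifference f y (fun j => ladderSucc (P.values j) (b j) (y j))|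

/-- The Vitali variation of `f` on `[a,b]`, in `[0,∞]`. -/
def vitaliVariation {ι : Type} [Fintype ι] [DecidableEq ι] (a b : ι → ℝ)
    (f : (ι → ℝ) → ℝ) : ℝ≥0∞ :=
  ⨆ P : Ladder a b, ENNReal.ofReal (P.variation f)

/-- `x ↦ f(x^{-u} : b^u)`, a function of the coordinates outside `u` only; the coordinates in
`u` are frozen at the values of `b`. -/
def freezeAt {ι : Type} [DecidableEq ι] (f : (ι → ℝ) → ℝ) (b : ι → ℝ) (u : Finset ι)
    (x : {i : ι // i ∉ u} → ℝ) : ℝ :=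
  f (fun i => if h : i ∉ u then x ⟨i, h⟩ else b i)

/-- The Hardy-Krause variation of `f` on `[a,b]`, in `[0,∞]`: the sum over all proper subsets `u`
of the coordinates of the Vitali variations of `f(x^{-u} : b^u)` on `[a^{-u}, b^{-u}]`. -/
def hardyKrauseVariation {ι : Type} [Fintype ι] [DecidableEq ι] (a b : ι → ℝ)
    (f : (ι → ℝ) → ℝ) : ℝ≥0∞ :=
  ∑ u ∈ (Finset.univ : Finset ι).ssubsets,
    vitaliVariation (fun i : {i : ι // i ∉ u} => a i) (fun i : {i : ι // i ∉ u} => b i)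
      (freezeAt f b u)

/-! ### Feedforward neural networks -/

/-- The weights and biases `θ = (W_k, b_k)_{1 ≤ k ≤ K}` of a feedforward network with `K` affine
layers (that is, `K - 1` hidden layers, of arbitrary widths), input dimension `m` and output
dimension `n`. -/
inductive NetworkParams : ℕ → ℕ → ℕ → Type
  | output {m n : ℕ} (W : Matrix (Fin n) (Fin m) ℝ) (b : Fin n → ℝ) : NetworkParams 1 m n
  | hidden {K m k n : ℕ} (W : Matrix (Fin k) (Fin m) ℝ) (b : Fin k → ℝ)
      (rest : NetworkParams K k n) : NetworkParams (K + 1) m n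

/-- The map `C_K ∘ σ ∘ C_{K-1} ∘ ⋯ ∘ σ ∘ C_1` with `C_k z = W_k z + b_k` and with the scalar
activation function `σ` applied componentwise. -/
def NetworkParams.realize (σ : ℝ → ℝ) :
    {K m n : ℕ} → NetworkParams K m n → (Fin m → ℝ) → (Fin n → ℝ)
  | _, _, _, .output W b, z => W.mulVec z + b
  | _, _, _, .hidden W b rest, z => rest.realize σ (fun i => σ ((W.mulVec z + b) i))

/-- The real-valued function `L_θ` of a network with one output neuron. -/
def neuralNetwork (σ : ℝ → ℝ) {K d : ℕ} (θ : NetworkParams K d 1) (y : Fin d → ℝ) : ℝ :=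
  θ.realize σ y 0

/-! ### Errors -/

/-- The generalization error `E_G = ∫_Y |L(y) - L*(y)| dy`. -/
def generalizationError {d : ℕ} (L Lstar : (Fin d → ℝ) → ℝ) : ℝ :=
  ∫ y in unitCube d, |L y - Lstar y|

/-- The training error `E_T = (1/N) ∑ |L(y_n) - L*(y_n)|`. -/
def trainingError {d N : ℕ} (y : Fin N → Fin d → ℝ) (L Lstar : (Fin d → ℝ) → ℝ) : ℝ :=
  (1 / (N : ℝ)) * ∑ n : Fin N, |L (y n) - Lstar (y n)|

end

/-!
The statement is the Koksma-Hlawka inequality `|∫ f - (1/N) ∑ f(y_n)| ≤ D*_N V_HK(f)` for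
`f = |L - L*|`, with nothing assumed about `f` except the finiteness of its variation.

At a point `x` of a finite grid `G^d`, where `G ⊆ [0, 1)` and the coordinate `1` is allowed as
well, `f(x)` is the sum over the sets `u` of coordinates and over the cells `[y, y₊]` of the grid
outside `u` of `± Δ_y f(· : 1^u) · 1[x ∈ [0, (y : 1^u)]]` (`gridSum_boxIndicator`). In one variable
this is the telescoping `f(x) = f(1) - ∑_{s ≥ x} (f(s₊) - f(s))`; in several variables it follows by
taking products. Written as `f(x) = gridSum G f (boxIndicator x)`, the formula is linear in the
indicator, and its coefficients outside the full set `u` sum in absolute value to at most `V_HK(f)`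
(`sum_abs_gridSum_le`).

If the grid contains the coordinates of all `y_n`, averaging the indicators over the points and
integrating them over the cube gives two Stieltjes sums that differ by that of the local
discrepancy, hence by at most `D*_N V_HK(f)`. The integrated function is the step function `f ∘ c`,
with `c` rounding up to the grid, and it remains to refine the grid
(`tendsto_setIntegral_gridSum`). For this the formula is used a second time: it shows that the
increments of `f` along a monotone chain add up to at most `V_HK(f)`
(`sum_abs_sub_le_of_monotone`), so `f` is a difference of monotone functions
(`exists_monotone_sub`). Monotone functions are continuous almost everywhere because frontiers of
upper sets are null, so `f ∘ c → f` almost everywhere, boundedly.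

When `V_HK(f) = ∞` the right-hand side must be seen to be `∞` and not `0 * ∞ = 0`: in positive
dimension the star discrepancy is positive (`starDiscrepancy_pos`), which forces the constant and
`log N` to be positive.
-/

noncomputable section

variable {ι : Type} [Fintype ι] [DecidableEq ι]

/-! ### Discrete Stieltjes sums over a grid -/

lemma ladderSucc_mem (G : Finset ℝ) (t : ℝ) : ladderSucc G 1 t ∈ insert 1 G := by
  unfold ladderSucc
  split_ifs with h
  · exact Finset.mem_insert_of_mem (Finset.mem_filter.1 (Finset.min'_mem _ h)).1
  · exact Finset.mem_insert_self _ _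

lemma filter_lt_eq_filter_ladderSucc_le {G : Finset ℝ} (hG : ∀ s ∈ G, s < 1) (t : ℝ) :
    G.filter (fun s => t < s) = G.filter (fun s => ladderSucc G 1 t ≤ s) := by
  unfold ladderSucc
  split_ifs with h
  · refine Finset.filter_congr fun s hs => ⟨fun hts => ?_, fun hts => ?_⟩
    · exact Finset.min'_le _ _ (Finset.mem_filter.2 ⟨hs, hts⟩)
    · exact (Finset.mem_filter.1 (Finset.min'_mem _ h)).2.trans_le hts
  · rw [Finset.not_nonempty_iff_eq_empty.1 h, eq_comm]
    exact Finset.filter_eq_empty_iff.2 fun s hs => not_le.2 (hG s hs)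

/-- Telescoping along the grid from the grid point `t` up to the endpoint `1`. -/
lemma sum_jumps_eq {G : Finset ℝ} (hG : ∀ s ∈ G, s < 1) (h : ℝ → ℝ) :
    ∀ (n : ℕ) (t : ℝ), t ∈ insert 1 G → (G.filter (fun s => t ≤ s)).card = n →
      ∑ s ∈ G.filter (fun s => t ≤ s), (h (ladderSucc G 1 s) - h s) = h 1 - h t := by
  intro n
  induction n with
  | zero =>
    intro t ht hn
    have h0 := Finset.card_eq_zero.1 hn
    have : t = 1 := by
      rcases Finset.mem_insert.1 ht with h1 | h1
      · exact h1
      · exact absurd (Finset.mem_filter.2 ⟨h1, le_refl t⟩) (by rw [h0]; simp)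
    rw [h0, this]; simp
  | succ n ih =>
    intro t ht hn
    have htG : t ∈ G := by
      rcases Finset.mem_insert.1 ht with h1 | h1
      · have : G.filter (fun s => t ≤ s) = ∅ :=
          Finset.filter_eq_empty_iff.2 fun s hs => not_le.2 (h1 ▸ hG s hs)
        rw [this] at hn; simp at hn
      · exact h1
    have hsplit : G.filter (fun s => t ≤ s) = insert t (G.filter (fun s => t < s)) := by
      ext s
      simp only [Finset.mem_filter, Finset.mem_insert]
      constructor
      · rintro ⟨hs, hts⟩
        rcases hts.eq_or_lt with h1 | h1
        · exact Or.inl h1.symm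
        · exact Or.inr ⟨hs, h1⟩
      · rintro (rfl | ⟨hs, hts⟩)
        · exact ⟨htG, le_rfl⟩
        · exact ⟨hs, hts.le⟩
    have hnot : t ∉ G.filter (fun s => t < s) := by simp
    rw [hsplit, Finset.card_insert_of_notMem hnot] at hn
    have hn' : (G.filter (fun s => t < s)).card = n := by omega
    rw [hsplit, Finset.sum_insert hnot, filter_lt_eq_filter_ladderSucc_le hG,
      ih _ (ladderSucc_mem G t) (by rw [← filter_lt_eq_filter_ladderSucc_le hG]; exact hn')]
    ring

/-- The point with coordinates `y` outside `u` and `1` in `u`. -/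
def fillOne (u : Finset ι) (y : {i : ι // i ∉ u} → ℝ) : ι → ℝ :=
  fun i => if h : i ∉ u then y ⟨i, h⟩ else 1

/-- The alternating sum of `f`, with the coordinates in `u` frozen at `1`, over the cell of the
grid `G` whose lower corner is `y`. -/
def cellJump (G : Finset ℝ) (f : (ι → ℝ) → ℝ) (u : Finset ι) (y : {i : ι // i ∉ u} → ℝ) : ℝ :=
  boxDifference (freezeAt f 1 u) y (fun j => ladderSucc G 1 (y j))

/-- The discrete analogue of `∑_u (-1)^|uᶜ| ∫ r(y : 1^u) df(y : 1^u)`, the integral being a sum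
over the cells of the grid `G` in the coordinates outside `u`. All subsets `u` occur here; the
full set contributes `f(1) r(1)`. -/
def gridSum (G : Finset ℝ) (f r : (ι → ℝ) → ℝ) : ℝ :=
  ∑ u : Finset ι, ∑ y ∈ Fintype.piFinset (fun _ : {i : ι // i ∉ u} => G),
    (-1) ^ (uᶜ.card) * cellJump G f u y * r (fillOne u y)

lemma gridSum_add (G : Finset ℝ) (f r r' : (ι → ℝ) → ℝ) :
    gridSum G f (fun z => r z + r' z) = gridSum G f r + gridSum G f r' := by
  simp only [gridSum, mul_add, Finset.sum_add_distrib]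

lemma gridSum_const_mul (G : Finset ℝ) (f r : (ι → ℝ) → ℝ) (c : ℝ) :
    gridSum G f (fun z => c * r z) = c * gridSum G f r := by
  simp only [gridSum, Finset.mul_sum]
  exact Finset.sum_congr rfl fun u _ => Finset.sum_congr rfl fun y _ => by ring

lemma gridSum_sub (G : Finset ℝ) (f r r' : (ι → ℝ) → ℝ) :
    gridSum G f (fun z => r z - r' z) = gridSum G f r - gridSum G f r' := by
  simp only [gridSum, mul_sub, Finset.sum_sub_distrib]

lemma gridSum_sum {κ : Type*} (G : Finset ℝ) (f : (ι → ℝ) → ℝ) (s : Finset κ)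
    (r : κ → (ι → ℝ) → ℝ) :
    gridSum G f (fun z => ∑ k ∈ s, r k z) = ∑ k ∈ s, gridSum G f (r k) := by
  classical
  induction s using Finset.induction_on with
  | empty => simp [gridSum]
  | insert a s ha ih => simp only [Finset.sum_insert ha, gridSum_add, ih]

lemma cellJump_congr {G : Finset ℝ} {f g : (ι → ℝ) → ℝ}
    (h : ∀ x : ι → ℝ, (∀ i, x i ∈ insert 1 G) → f x = g x) {u : Finset ι}
    {y : {i : ι // i ∉ u} → ℝ} (hy : ∀ i, y i ∈ G) : cellJump G f u y = cellJump G g u y := by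
  unfold cellJump boxDifference freezeAt
  refine Finset.sum_congr rfl fun v _ => ?_
  rw [h]
  intro i
  split_ifs with hi
  · exact Finset.mem_insert_self _ _
  · unfold glue
    split_ifs
    · exact Finset.mem_insert_of_mem (hy _)
    · exact ladderSucc_mem _ _

lemma gridSum_congr_left {G : Finset ℝ} {f g : (ι → ℝ) → ℝ}
    (h : ∀ x : ι → ℝ, (∀ i, x i ∈ insert 1 G) → f x = g x) (r : (ι → ℝ) → ℝ) :
    gridSum G f r = gridSum G g r := by
  refine Finset.sum_congr rfl fun u _ => Finset.sum_congr rfl fun y hy => ?_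
  rw [cellJump_congr h (Fintype.mem_piFinset.1 hy)]

lemma cellJump_linear {κ : Type*} (G : Finset ℝ) (s : Finset κ) (c : κ → ℝ)
    (φ : κ → (ι → ℝ) → ℝ) (u : Finset ι) (y : {i : ι // i ∉ u} → ℝ) :
    cellJump G (fun x => ∑ k ∈ s, c k * φ k x) u y = ∑ k ∈ s, c k * cellJump G (φ k) u y := by
  simp only [cellJump, boxDifference, freezeAt, Finset.mul_sum]
  rw [Finset.sum_comm]
  exact Finset.sum_congr rfl fun k _ => Finset.sum_congr rfl fun v _ => by ring

lemma gridSum_linear_left {κ : Type*} (G : Finset ℝ) (s : Finset κ) (c : κ → ℝ)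
    (φ : κ → (ι → ℝ) → ℝ) (r : (ι → ℝ) → ℝ) :
    gridSum G (fun x => ∑ k ∈ s, c k * φ k x) r = ∑ k ∈ s, c k * gridSum G (φ k) r := by
  simp only [gridSum, cellJump_linear, Finset.mul_sum, Finset.sum_mul]
  rw [Finset.sum_comm (s := s)]
  refine Finset.sum_congr rfl fun u _ => ?_
  rw [Finset.sum_comm]
  exact Finset.sum_congr rfl fun y _ => Finset.sum_congr rfl fun k _ => by ring

/-- The alternating sum of a product over the vertices of a box factorizes. -/
lemma boxDifference_prod {κ : Type} [Fintype κ] [DecidableEq κ] (h : κ → ℝ → ℝ) (x z : κ → ℝ) :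
    boxDifference (fun w => ∏ i, h i (w i)) x z = ∏ i, (h i (z i) - h i (x i)) := by
  have := Fintype.prod_add (fun i => - h i (x i)) (fun i => h i (z i))
  simp only [neg_add_eq_sub] at this
  rw [this]
  refine Finset.sum_congr rfl fun v _ => ?_
  rw [Finset.prod_neg, mul_assoc]
  congr 1
  beta_reduce
  rw [← Finset.prod_mul_prod_compl v]
  congr 1
  · exact Finset.prod_congr rfl fun i hi => by simp [glue, hi]
  · exact Finset.prod_congr rfl fun i hi => by simp [glue, Finset.mem_compl.1 hi]

lemma prod_compl_eq_prod_subtype (u : Finset ι) (F : ι → ℝ) :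
    ∏ i ∈ uᶜ, F i = ∏ i : {i : ι // i ∉ u}, F i :=
  Finset.prod_subtype _ (by simp) _

lemma freezeAt_prod (h : ι → ℝ → ℝ) (u : Finset ι) :
    freezeAt (fun w => ∏ i, h i (w i)) 1 u =
      fun y => (∏ i ∈ u, h i 1) * ∏ i : {i : ι // i ∉ u}, h i (y i) := by
  funext y
  unfold freezeAt
  beta_reduce
  rw [← Finset.prod_mul_prod_compl u, prod_compl_eq_prod_subtype]
  congr 1
  · exact Finset.prod_congr rfl fun i hi => by simp [hi]
  · exact Finset.prod_congr rfl fun i _ => by simp [i.2]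

lemma cellJump_prod (G : Finset ℝ) (h : ι → ℝ → ℝ) (u : Finset ι) (y : {i : ι // i ∉ u} → ℝ) :
    cellJump G (fun w => ∏ i, h i (w i)) u y =
      (∏ i ∈ u, h i 1) * ∏ i : {i : ι // i ∉ u}, (h i (ladderSucc G 1 (y i)) - h i (y i)) := by
  rw [cellJump, freezeAt_prod, ← boxDifference_prod (fun i : {i : ι // i ∉ u} => h i)]
  simp only [boxDifference, Finset.mul_sum]
  exact Finset.sum_congr rfl fun v _ => by ring

lemma mem_Icc_fillOne_iff {κ : Type} [DecidableEq κ] {u : Finset κ} {y : {i : κ // i ∉ u} → ℝ}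
    {x : κ → ℝ} (hx : x ∈ Set.Icc (0 : κ → ℝ) 1) :
    x ∈ Set.Icc 0 (fillOne u y) ↔ ∀ i : {i : κ // i ∉ u}, x i ≤ y i := by
  constructor
  · intro h i
    have := h.2 i
    simpa [fillOne, i.2] using this
  · refine fun h => ⟨hx.1, fun i => ?_⟩
    unfold fillOne
    split_ifs with hi
    · exact hx.2 i
    · exact h ⟨i, hi⟩

/-- The indicator of the box `[0, z]`, as a function of the corner `z`. -/
def boxIndicator (x z : ι → ℝ) : ℝ := (Set.Icc (0 : ι → ℝ) z).indicator (fun _ => 1) x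

lemma gridSum_boxIndicator_prod {G : Finset ℝ} (hG : ∀ s ∈ G, s < 1) (h : ι → ℝ → ℝ)
    {x : ι → ℝ} (hx : x ∈ Set.Icc (0 : ι → ℝ) 1) (hxG : ∀ i, x i ∈ insert 1 G) :
    gridSum G (fun w => ∏ i, h i (w i)) (boxIndicator x) = ∏ i, h i (x i) := by
  have hT : ∀ i, h i (x i) = h i 1 +
      -∑ s ∈ G, (h i (ladderSucc G 1 s) - h i s) * (if x i ≤ s then 1 else 0) := by
    intro i
    have := sum_jumps_eq hG (h i) _ (x i) (hxG i) rfl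
    rw [Finset.sum_filter] at this
    simp only [mul_ite, mul_one, mul_zero]
    rw [this]; ring
  rw [Finset.prod_congr rfl fun i _ => hT i, Fintype.prod_add]
  refine Finset.sum_congr rfl fun u _ => ?_
  rw [Finset.prod_neg, prod_compl_eq_prod_subtype, Finset.prod_univ_sum, Finset.mul_sum,
    Finset.mul_sum]
  refine Finset.sum_congr rfl fun y _ => ?_
  have hI : boxIndicator x (fillOne u y) =
      ∏ i : {i : ι // i ∉ u}, (if x i ≤ y i then (1 : ℝ) else 0) := by
    rw [Finset.prod_ite_zero, Finset.prod_const_one, boxIndicator]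
    by_cases hy : ∀ i : {i : ι // i ∉ u}, x i ≤ y i
    · rw [Set.indicator_of_mem ((mem_Icc_fillOne_iff hx).2 hy), if_pos fun i _ => hy i]
    · rw [Set.indicator_of_notMem (mt (mem_Icc_fillOne_iff hx).1 hy),
        if_neg fun h => hy fun i => h i (Finset.mem_univ i)]
  rw [cellJump_prod, hI, Finset.prod_mul_distrib]
  ring

/-- A function is recovered at a grid point from its jumps over the cells above that point.
On the grid every function is a linear combination of products of functions of one variable, and
for a product the formula is the product of the one-dimensional telescoping sums. -/
theorem gridSum_boxIndicator {G : Finset ℝ} (hG : ∀ s ∈ G, s < 1) (f : (ι → ℝ) → ℝ)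
    {x : ι → ℝ} (hx : x ∈ Set.Icc (0 : ι → ℝ) 1) (hxG : ∀ i, x i ∈ insert 1 G) :
    gridSum G f (boxIndicator x) = f x := by
  have hf : ∀ w : ι → ℝ, (∀ i, w i ∈ insert 1 G) → f w =
      ∑ g ∈ Fintype.piFinset (fun _ : ι => insert 1 G),
        f g * ∏ i, (if w i = g i then (1 : ℝ) else 0) := by
    intro w hw
    rw [Finset.sum_eq_single w]
    · simp
    · intro g _ hg
      obtain ⟨i, hi⟩ := Function.ne_iff.1 hg
      rw [Finset.prod_eq_zero (Finset.mem_univ i), mul_zero]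
      exact if_neg hi.symm
    · exact fun h => absurd (Fintype.mem_piFinset.2 hw) h
  rw [gridSum_congr_left hf, gridSum_linear_left, hf x hxG]
  refine Finset.sum_congr rfl fun g _ => ?_
  rw [gridSum_boxIndicator_prod hG (fun i t => if t = g i then (1 : ℝ) else 0) hx hxG]

/-! ### Bounds by the Hardy-Krause variation -/

/-- The grid in `[0, 1)` consisting of `0` and of the elements of `A` in `(0, 1)`. -/
def unitGrid (A : Finset ℝ) : Finset ℝ := insert 0 (A.filter (fun t => t ∈ Set.Ioo (0 : ℝ) 1))

lemma nonneg_of_mem_unitGrid {A : Finset ℝ} {s : ℝ} (hs : s ∈ unitGrid A) : 0 ≤ s := by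
  rcases Finset.mem_insert.1 hs with h | h
  · exact h.ge
  · exact (Finset.mem_filter.1 h).2.1.le

lemma lt_one_of_mem_unitGrid {A : Finset ℝ} : ∀ s ∈ unitGrid A, s < 1 := by
  intro s hs
  rcases Finset.mem_insert.1 hs with h | h
  · rw [h]; exact one_pos
  · exact (Finset.mem_filter.1 h).2.2

lemma mem_insert_one_unitGrid {A : Finset ℝ} {t : ℝ} (ht : t ∈ A) (h0 : 0 ≤ t) (h1 : t ≤ 1) :
    t ∈ insert 1 (unitGrid A) := by
  rcases h1.eq_or_lt with rfl | h1
  · exact Finset.mem_insert_self _ _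
  rcases h0.eq_or_lt with rfl | h0
  · exact Finset.mem_insert_of_mem (Finset.mem_insert_self _ _)
  · exact Finset.mem_insert_of_mem
      (Finset.mem_insert_of_mem (Finset.mem_filter.2 ⟨ht, h0, h1⟩))

lemma sum_abs_cellJump_le_vitaliVariation (A : Finset ℝ) (f : (ι → ℝ) → ℝ) (u : Finset ι) :
    ENNReal.ofReal (∑ y ∈ Fintype.piFinset (fun _ : {i : ι // i ∉ u} => unitGrid A),
        |cellJump (unitGrid A) f u y|) ≤
      vitaliVariation (fun i : {i : ι // i ∉ u} => (0 : ι → ℝ) i)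
        (fun i : {i : ι // i ∉ u} => (1 : ι → ℝ) i) (freezeAt f 1 u) :=
  le_iSup (fun P : Ladder (fun i : {i : ι // i ∉ u} => (0 : ι → ℝ) i)
      (fun i : {i : ι // i ∉ u} => (1 : ι → ℝ) i) => ENNReal.ofReal (P.variation (freezeAt f 1 u)))
    ⟨fun _ => A.filter (fun t => t ∈ Set.Ioo (0 : ℝ) 1), fun _ _ ht => (Finset.mem_filter.1 ht).2⟩

lemma sum_abs_cellJump_le_hardyKrauseVariation (A : Finset ℝ) (f : (ι → ℝ) → ℝ)
    (hV : hardyKrauseVariation 0 1 f ≠ ∞) :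
    ∑ u ∈ (Finset.univ : Finset ι).ssubsets,
        ∑ y ∈ Fintype.piFinset (fun _ : {i : ι // i ∉ u} => unitGrid A),
          |cellJump (unitGrid A) f u y| ≤ (hardyKrauseVariation 0 1 f).toReal := by
  rw [← ENNReal.ofReal_le_iff_le_toReal hV, ENNReal.ofReal_sum_of_nonneg fun u _ =>
    Finset.sum_nonneg fun y _ => abs_nonneg _]
  exact Finset.sum_le_sum fun u _ => sum_abs_cellJump_le_vitaliVariation A f u

lemma fillOne_mem_Icc {A : Finset ℝ} {u : Finset ι} {y : {i : ι // i ∉ u} → ℝ}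
    (hy : y ∈ Fintype.piFinset (fun _ : {i : ι // i ∉ u} => unitGrid A)) :
    fillOne u y ∈ Set.Icc (0 : ι → ℝ) 1 := by
  rw [Fintype.mem_piFinset] at hy
  constructor <;> intro i <;> unfold fillOne <;> split_ifs
  · exact zero_le_one
  · exact nonneg_of_mem_unitGrid (hy _)
  · exact le_rfl
  · exact (lt_one_of_mem_unitGrid _ (hy _)).le

/-- Stieltjes sums against functions `r k` that vanish at `1` and satisfy `∑ k, |r k| ≤ B` are
bounded by `B` times the Hardy-Krause variation: the full set `u`, which does not occur in that
variation, only sees the value at `1`. -/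
lemma sum_abs_gridSum_le {κ : Type*} (A : Finset ℝ) (f : (ι → ℝ) → ℝ)
    (hV : hardyKrauseVariation 0 1 f ≠ ∞) (s : Finset κ) (r : κ → (ι → ℝ) → ℝ) {B : ℝ}
    (hB : ∀ z ∈ Set.Icc (0 : ι → ℝ) 1, ∑ k ∈ s, |r k z| ≤ B) (h1 : ∀ k, r k 1 = 0) :
    ∑ k ∈ s, |gridSum (unitGrid A) f (r k)| ≤ B * (hardyKrauseVariation 0 1 f).toReal := by
  have hB0 : 0 ≤ B := (Finset.sum_nonneg fun k _ => abs_nonneg _).trans (hB 1 ⟨zero_le_one, le_rfl⟩)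
  have hle : ∀ k, |gridSum (unitGrid A) f (r k)| ≤ ∑ u ∈ (Finset.univ : Finset ι).ssubsets,
      ∑ y ∈ Fintype.piFinset (fun _ : {i : ι // i ∉ u} => unitGrid A),
        |cellJump (unitGrid A) f u y| * |r k (fillOne u y)| := by
    intro k
    have : gridSum (unitGrid A) f (r k) = ∑ u ∈ (Finset.univ : Finset ι).ssubsets,
        ∑ y ∈ Fintype.piFinset (fun _ : {i : ι // i ∉ u} => unitGrid A),
          (-1) ^ (uᶜ.card) * cellJump (unitGrid A) f u y * r k (fillOne u y) := by
      refine (Finset.sum_subset (Finset.subset_univ _) fun u _ hu => ?_).symm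
      have hu' : u = Finset.univ := by
        by_contra h
        exact hu (Finset.mem_ssubsets.2 (Finset.ssubset_univ_iff.2 h))
      refine Finset.sum_eq_zero fun y _ => ?_
      have : fillOne u y = 1 := by
        funext i
        simp [fillOne, hu']
      rw [this, h1, mul_zero]
    rw [this]
    refine (Finset.abs_sum_le_sum_abs _ _).trans (Finset.sum_le_sum fun u _ => ?_)
    refine (Finset.abs_sum_le_sum_abs _ _).trans (Finset.sum_le_sum fun y _ => ?_)
    rw [abs_mul, abs_mul, abs_neg_one_pow, one_mul]
  calc ∑ k ∈ s, |gridSum (unitGrid A) f (r k)|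
      ≤ ∑ k ∈ s, ∑ u ∈ (Finset.univ : Finset ι).ssubsets,
          ∑ y ∈ Fintype.piFinset (fun _ : {i : ι // i ∉ u} => unitGrid A),
            |cellJump (unitGrid A) f u y| * |r k (fillOne u y)| :=
        Finset.sum_le_sum fun k _ => hle k
    _ = ∑ u ∈ (Finset.univ : Finset ι).ssubsets,
          ∑ y ∈ Fintype.piFinset (fun _ : {i : ι // i ∉ u} => unitGrid A),
            |cellJump (unitGrid A) f u y| * ∑ k ∈ s, |r k (fillOne u y)| := by
        rw [Finset.sum_comm]
        refine Finset.sum_congr rfl fun u _ => ?_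
        rw [Finset.sum_comm]
        exact Finset.sum_congr rfl fun y _ => (Finset.mul_sum _ _ _).symm
    _ ≤ ∑ u ∈ (Finset.univ : Finset ι).ssubsets,
          ∑ y ∈ Fintype.piFinset (fun _ : {i : ι // i ∉ u} => unitGrid A),
            B * |cellJump (unitGrid A) f u y| := by
        refine Finset.sum_le_sum fun u _ => Finset.sum_le_sum fun y hy => ?_
        rw [mul_comm B]
        exact mul_le_mul_of_nonneg_left (hB _ (fillOne_mem_Icc hy)) (abs_nonneg _)
    _ = B * ∑ u ∈ (Finset.univ : Finset ι).ssubsets,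
          ∑ y ∈ Fintype.piFinset (fun _ : {i : ι // i ∉ u} => unitGrid A),
            |cellJump (unitGrid A) f u y| := by
        simp only [Finset.mul_sum]
    _ ≤ B * (hardyKrauseVariation 0 1 f).toReal :=
        mul_le_mul_of_nonneg_left (sum_abs_cellJump_le_hardyKrauseVariation A f hV) hB0

/-! ### Monotone decomposition -/

lemma boxIndicator_of_mem {κ : Type} {x z : κ → ℝ} (h : x ∈ Set.Icc 0 z) :
    boxIndicator x z = 1 := Set.indicator_of_mem h _

lemma boxIndicator_of_not_le {κ : Type} {x z : κ → ℝ} (h : ¬ x ≤ z) : boxIndicator x z = 0 :=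
  Set.indicator_of_notMem (fun hx => h hx.2) _

lemma boxIndicator_nonneg {κ : Type} (x z : κ → ℝ) : 0 ≤ boxIndicator x z :=
  Set.indicator_nonneg (fun _ _ => zero_le_one) _

lemma boxIndicator_le_one {κ : Type} (x z : κ → ℝ) : boxIndicator x z ≤ 1 :=
  Set.indicator_le_self' (fun _ _ => zero_le_one) _

lemma boxIndicator_anti {κ : Type} {x x' z : κ → ℝ} (h0 : 0 ≤ x) (h : x ≤ x') :
    boxIndicator x' z ≤ boxIndicator x z := by
  by_cases hz : x ≤ z
  · rw [boxIndicator_of_mem ⟨h0, hz⟩]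
    exact boxIndicator_le_one _ _
  · rw [boxIndicator_of_not_le hz, boxIndicator_of_not_le fun h' => hz (h.trans h')]

/-- The total increment of `f` along a monotone chain in the cube is at most the Hardy-Krause
variation: on a grid through the chain, the indicators `1_{[0, z]}` decrease along the chain, so
each cell is counted at most once. -/
lemma sum_abs_sub_le_of_monotone (f : (ι → ℝ) → ℝ) (hV : hardyKrauseVariation 0 1 f ≠ ∞)
    {c : ℕ → ι → ℝ} (hc : Monotone c) (hc1 : ∀ k, c k ∈ Set.Icc (0 : ι → ℝ) 1) (n : ℕ) :
    ∑ k ∈ Finset.range n, |f (c (k + 1)) - f (c k)| ≤ (hardyKrauseVariation 0 1 f).toReal := by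
  set A : Finset ℝ := (Finset.range (n + 1) ×ˢ (Finset.univ : Finset ι)).image
    (fun p => c p.1 p.2) with hA
  have hrep : ∀ k < n + 1, f (c k) = gridSum (unitGrid A) f (boxIndicator (c k)) := by
    intro k hk
    refine (gridSum_boxIndicator lt_one_of_mem_unitGrid f (hc1 k) fun i => ?_).symm
    refine mem_insert_one_unitGrid ?_ ((hc1 k).1 i) ((hc1 k).2 i)
    exact Finset.mem_image.2 ⟨(k, i), by simpa using hk, rfl⟩
  have key := sum_abs_gridSum_le A f hV (Finset.range n)
    (fun k z => boxIndicator (c (k + 1)) z - boxIndicator (c k) z) (B := 1) ?_ ?_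
  · rw [one_mul] at key
    refine le_of_eq_of_le (Finset.sum_congr rfl fun k hk => ?_) key
    have hk := Finset.mem_range.1 hk
    rw [gridSum_sub, hrep k (by omega), hrep (k + 1) (by omega)]
  · intro z _
    have : ∀ k ∈ Finset.range n, |boxIndicator (c (k + 1)) z - boxIndicator (c k) z| =
        boxIndicator (c k) z - boxIndicator (c (k + 1)) z := fun k _ => by
      rw [abs_sub_comm, abs_of_nonneg
        (sub_nonneg.2 (boxIndicator_anti (hc1 k).1 (hc (Nat.le_succ k))))]
    rw [Finset.sum_congr rfl this, Finset.sum_range_sub']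
    linarith [boxIndicator_le_one (c 0) z, boxIndicator_nonneg (c n) z]
  · intro k
    rw [boxIndicator_of_mem (hc1 _), boxIndicator_of_mem (hc1 _), sub_self]

/-- The supremum of the total increments of `f` along the monotone chains in `[0, x]`. -/
def chainVariation (f : (ι → ℝ) → ℝ) (x : ι → ℝ) : ℝ :=
  sSup {s | ∃ (c : ℕ → ι → ℝ) (n : ℕ), Monotone c ∧ (∀ k, c k ∈ Set.Icc 0 x) ∧
    s = ∑ k ∈ Finset.range n, |f (c (k + 1)) - f (c k)|}

lemma le_chainVariation (f : (ι → ℝ) → ℝ) (hV : hardyKrauseVariation 0 1 f ≠ ∞) {x : ι → ℝ}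
    (hx : x ≤ 1) {c : ℕ → ι → ℝ} (hc : Monotone c) (hcx : ∀ k, c k ∈ Set.Icc 0 x) (n : ℕ) :
    ∑ k ∈ Finset.range n, |f (c (k + 1)) - f (c k)| ≤ chainVariation f x := by
  refine le_csSup ⟨(hardyKrauseVariation 0 1 f).toReal, ?_⟩ ⟨c, n, hc, hcx, rfl⟩
  rintro _ ⟨c, n, hc, hcx, rfl⟩
  exact sum_abs_sub_le_of_monotone f hV hc (fun k => ⟨(hcx k).1, (hcx k).2.trans hx⟩) n

lemma chainVariation_le {κ : Type} {f : (κ → ℝ) → ℝ} {x : κ → ℝ} (hx : 0 ≤ x) {M : ℝ}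
    (h : ∀ (c : ℕ → κ → ℝ) (n : ℕ), Monotone c → (∀ k, c k ∈ Set.Icc 0 x) →
      ∑ k ∈ Finset.range n, |f (c (k + 1)) - f (c k)| ≤ M) : chainVariation f x ≤ M := by
  refine csSup_le ⟨_, fun _ => x, 0, monotone_const, fun _ => ⟨hx, le_rfl⟩, rfl⟩ ?_
  rintro _ ⟨c, n, hc, hcx, rfl⟩
  exact h c n hc hcx

lemma chainVariation_add_abs_sub_le (f : (ι → ℝ) → ℝ) (hV : hardyKrauseVariation 0 1 f ≠ ∞)
    {x x' : ι → ℝ} (h0 : 0 ≤ x) (h : x ≤ x') (h1 : x' ≤ 1) :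
    chainVariation f x + |f x' - f x| ≤ chainVariation f x' := by
  rw [← le_sub_iff_add_le]
  refine chainVariation_le h0 fun c n hc hcx => ?_
  rw [le_sub_iff_add_le]
  -- The chain is prolonged by `x` and then by `x'`.
  set e : ℕ → ι → ℝ := fun k => if k ≤ n then c k else if k = n + 1 then x else x' with he
  have hec : ∀ k ≤ n, e k = c k := fun k hk => if_pos hk
  have he1 : e (n + 1) = x := by simp [he]
  have he2 : e (n + 2) = x' := by simp [he]
  have hmono : Monotone e := by
    refine monotone_nat_of_le_succ fun k => ?_
    rcases lt_trichotomy k n with hk | hk | hk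
    · rw [hec k hk.le, hec (k + 1) hk]; exact hc (Nat.le_succ k)
    · rw [hk, hec n le_rfl, he1]; exact (hcx n).2
    · have h2 : e (k + 1) = x' := by
        simp only [he]; rw [if_neg (by omega), if_neg (by omega)]
      rw [h2]
      simp only [he]
      rw [if_neg (by omega)]
      split_ifs
      · exact h
      · exact le_rfl
  have hmem : ∀ k, e k ∈ Set.Icc 0 x' := by
    intro k
    simp only [he]
    split_ifs
    · exact ⟨(hcx k).1, (hcx k).2.trans h⟩
    · exact ⟨h0, h⟩
    · exact ⟨h0.trans h, le_rfl⟩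
  have key := le_chainVariation f hV h1 hmono hmem (n + 2)
  rw [Finset.sum_range_succ, Finset.sum_range_succ, he1, he2] at key
  have hsum : ∑ k ∈ Finset.range n, |f (e (k + 1)) - f (e k)| =
      ∑ k ∈ Finset.range n, |f (c (k + 1)) - f (c k)| := by
    refine Finset.sum_congr rfl fun k hk => ?_
    have hk := Finset.mem_range.1 hk
    rw [hec k hk.le, hec (k + 1) hk]
  rw [hsum] at key
  linarith [abs_nonneg (f x - f (e n))]

lemma abs_sub_le_hardyKrauseVariation (f : (ι → ℝ) → ℝ) (hV : hardyKrauseVariation 0 1 f ≠ ∞)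
    {x : ι → ℝ} (hx : x ∈ Set.Icc (0 : ι → ℝ) 1) :
    |f 1 - f x| ≤ (hardyKrauseVariation 0 1 f).toReal := by
  have := sum_abs_sub_le_of_monotone f hV (c := fun k => if k = 0 then x else 1)
    (monotone_nat_of_le_succ fun k => by
      split_ifs <;> simp_all [hx.2]) (fun k => by
      split_ifs
      · exact hx
      · exact ⟨zero_le_one, le_rfl⟩) 1
  simpa using this

/-- A function of finite Hardy-Krause variation is, on the cube, a difference of monotone
functions. -/
lemma exists_monotone_sub (f : (ι → ℝ) → ℝ) (hV : hardyKrauseVariation 0 1 f ≠ ∞) :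
    ∃ p q : (ι → ℝ) → ℝ, Monotone p ∧ Monotone q ∧
      ∀ x ∈ Set.Icc (0 : ι → ℝ) 1, f x = p x - q x := by
  -- The clamping map makes the functions monotone on the whole space.
  set κ : (ι → ℝ) → ι → ℝ := fun x => (x ⊓ 1) ⊔ 0 with hκ
  have hκm : Monotone κ := fun x x' h => sup_le_sup_right (inf_le_inf_right _ h) _
  have h0 : ∀ x, 0 ≤ κ x := fun x => le_sup_right
  have h1 : ∀ x, κ x ≤ 1 := fun x => sup_le inf_le_right zero_le_one
  refine ⟨fun x => chainVariation f (κ x), fun x => chainVariation f (κ x) - f (κ x),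
    fun x x' h => ?_, fun x x' h => ?_, fun x hx => ?_⟩
  · have := chainVariation_add_abs_sub_le f hV (h0 x) (hκm h) (h1 x')
    exact (le_add_of_nonneg_right (abs_nonneg _)).trans this
  · have := chainVariation_add_abs_sub_le f hV (h0 x) (hκm h) (h1 x')
    beta_reduce
    linarith [le_abs_self (f (κ x') - f (κ x))]
  · have : κ x = x := by simp only [hκ]; rw [inf_eq_left.2 hx.2, sup_eq_left.2 hx.1]
    simp [this]

/-- A monotone function of several real variables is continuous almost everywhere: its
discontinuities lie on the frontiers of its superlevel sets at rational levels. -/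
lemma Monotone.ae_continuousAt_pi {κ : Type} [Fintype κ] {p : (κ → ℝ) → ℝ} (hp : Monotone p) :
    ∀ᵐ x, ContinuousAt p x := by
  have h : ∀ᵐ x, ∀ q : ℚ, x ∉ frontier {x | (q : ℝ) < p x} := by
    refine ae_all_iff.2 fun q => ?_
    have hup : IsUpperSet {x | (q : ℝ) < p x} := fun x x' hxx' hx => lt_of_lt_of_le hx (hp hxx')
    exact measure_eq_zero_iff_ae_notMem.1 hup.null_frontier
  filter_upwards [h] with x hx
  refine tendsto_order.2 ⟨fun a ha => ?_, fun a ha => ?_⟩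
  · obtain ⟨q, haq, hq⟩ := exists_rat_btwn ha
    have : x ∈ interior {x | (q : ℝ) < p x} := by
      by_contra hn
      exact hx q ⟨subset_closure hq, hn⟩
    filter_upwards [mem_interior_iff_mem_nhds.1 this] with z hz using haq.trans hz
  · obtain ⟨q, hq, hqa⟩ := exists_rat_btwn ha
    have : x ∉ closure {x | (q : ℝ) < p x} := fun hn =>
      hx q ⟨hn, fun hi =>
        lt_asymm hq (interior_subset (s := {x | (q : ℝ) < p x}) hi)⟩
    have hnhds := isClosed_closure.isOpen_compl.mem_nhds this
    filter_upwards [hnhds] with z hz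
    exact (not_lt.1 fun h => hz (subset_closure h)).trans_lt hqa

/-! ### Convergence of the step functions -/

lemma exists_gridCeil (A : Finset ℝ) {t : ℝ} (ht : t ≤ 1) :
    ∃ c ∈ insert 1 (unitGrid A), t ≤ c ∧ ∀ s ∈ insert 1 (unitGrid A), t ≤ s → c ≤ s := by
  obtain ⟨c, hc, hmin⟩ := Finset.exists_min_image
    ((insert 1 (unitGrid A)).filter (fun s => t ≤ s)) id
    ⟨1, Finset.mem_filter.2 ⟨Finset.mem_insert_self _ _, ht⟩⟩
  rw [Finset.mem_filter] at hc
  exact ⟨c, hc.1, hc.2, fun s hs hts => hmin s (Finset.mem_filter.2 ⟨hs, hts⟩)⟩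

/-- On the cube `x ↦ gridSum G f (boxIndicator x)` is the step function `f ∘ c`, where `c` rounds
each coordinate up to the grid. -/
lemma exists_gridSum_boxIndicator_eq (A : Finset ℝ) (f : (ι → ℝ) → ℝ) {x : ι → ℝ}
    (hx : x ∈ Set.Icc (0 : ι → ℝ) 1) :
    ∃ c ∈ Set.Icc (0 : ι → ℝ) 1, x ≤ c ∧ gridSum (unitGrid A) f (boxIndicator x) = f c ∧
      ∀ i, ∀ s ∈ insert 1 (unitGrid A), x i ≤ s → c i ≤ s := by
  choose c hcG hxc hmin using fun i => exists_gridCeil A (hx.2 i)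
  have hc : c ∈ Set.Icc (0 : ι → ℝ) 1 :=
    ⟨hx.1.trans hxc, fun i => hmin i 1 (Finset.mem_insert_self _ _) (hx.2 i)⟩
  refine ⟨c, hc, hxc, ?_, hmin⟩
  rw [← gridSum_boxIndicator lt_one_of_mem_unitGrid f hc hcG]
  refine Finset.sum_congr rfl fun u _ => Finset.sum_congr rfl fun y hy => ?_
  rw [Fintype.mem_piFinset] at hy
  congr 1
  by_cases h : x ≤ fillOne u y
  · have h' : c ≤ fillOne u y := by
      intro i
      refine hmin i _ ?_ (h i)
      unfold fillOne
      split_ifs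
      · exact Finset.mem_insert_self _ _
      · exact Finset.mem_insert_of_mem (hy _)
    rw [boxIndicator_of_mem ⟨hx.1, h⟩, boxIndicator_of_mem ⟨hc.1, h'⟩]
  · rw [boxIndicator_of_not_le h, boxIndicator_of_not_le fun h' => h (le_trans hxc h')]

lemma integrable_boxIndicator {κ : Type} [Fintype κ] (z : κ → ℝ) : Integrable (fun x => boxIndicator x z) :=
  (integrable_indicator_iff measurableSet_Icc).2 (integrableOn_const isCompact_Icc.measure_ne_top)

lemma setIntegral_boxIndicator {κ : Type} [Fintype κ] {z : κ → ℝ} (hz : z ≤ 1) :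
    ∫ x in Set.Icc (0 : κ → ℝ) 1, boxIndicator x z = (volume (Set.Icc 0 z)).toReal := by
  unfold boxIndicator
  rw [setIntegral_indicator measurableSet_Icc, setIntegral_const, smul_eq_mul, mul_one,
    Set.inter_eq_right.2 (Set.Icc_subset_Icc le_rfl hz), measureReal_def]

lemma integrable_gridSum_boxIndicator (G : Finset ℝ) (f : (ι → ℝ) → ℝ) :
    Integrable (fun x => gridSum G f (boxIndicator x)) :=
  integrable_finsetSum _ fun _ _ => integrable_finsetSum _ fun _ _ =>
    (integrable_boxIndicator _).const_mul _

lemma setIntegral_gridSum_boxIndicator (A : Finset ℝ) (f : (ι → ℝ) → ℝ) :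
    ∫ x in Set.Icc (0 : ι → ℝ) 1, gridSum (unitGrid A) f (boxIndicator x) =
      gridSum (unitGrid A) f (fun z => (volume (Set.Icc 0 z)).toReal) := by
  have hint : ∀ (a : ℝ) (z : ι → ℝ), Integrable (fun x => a * boxIndicator x z)
      (volume.restrict (Set.Icc (0 : ι → ℝ) 1)) := fun a z =>
    ((integrable_boxIndicator z).const_mul a).restrict
  unfold gridSum
  rw [integral_finsetSum _ fun u _ => integrable_finsetSum _ fun y _ => hint _ _]
  refine Finset.sum_congr rfl fun u _ => ?_
  rw [integral_finsetSum _ fun y _ => hint _ _]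
  refine Finset.sum_congr rfl fun y hy => ?_
  rw [integral_const_mul, setIntegral_boxIndicator (fillOne_mem_Icc hy).2]

/-- The integrals of the step functions `f ∘ c`, with `c` rounding up to a grid of mesh at most
`1 / (m + 1)`, converge to the integral of `f`. The grid may be required to contain a given finite
set `A`. That `f` is a.e. measurable on the cube is not needed beforehand: `f ∘ c` is a finite sum
of indicators of boxes, and it converges to `f` wherever the two monotone parts of `f` are
continuous. -/
lemma tendsto_setIntegral_gridSum (f : (ι → ℝ) → ℝ) (hV : hardyKrauseVariation 0 1 f ≠ ∞)
    (A : Finset ℝ) :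
    Filter.Tendsto (fun m : ℕ => ∫ x in Set.Icc (0 : ι → ℝ) 1,
        gridSum (unitGrid (A ∪ (Finset.range (m + 1)).image (fun k : ℕ => (k : ℝ) / (m + 1)))) f
          (boxIndicator x)) Filter.atTop (nhds (∫ x in Set.Icc (0 : ι → ℝ) 1, f x)) := by
  refine tendsto_integral_of_dominated_convergence
    (fun _ => |f 1| + (hardyKrauseVariation 0 1 f).toReal)
    (fun m => (integrable_gridSum_boxIndicator _ f).aestronglyMeasurable.restrict)
    (integrableOn_const isCompact_Icc.measure_ne_top) (fun m => ?_) ?_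
  · filter_upwards [ae_restrict_mem measurableSet_Icc] with x hx
    obtain ⟨c, hc, -, h, -⟩ := exists_gridSum_boxIndicator_eq
      (A ∪ (Finset.range (m + 1)).image (fun k : ℕ => (k : ℝ) / (m + 1))) f hx
    rw [h, Real.norm_eq_abs]
    have h1 := abs_sub_le_hardyKrauseVariation f hV hc
    have h2 := abs_sub_abs_le_abs_sub (f c) (f 1)
    rw [abs_sub_comm] at h2
    linarith
  · obtain ⟨p, q, hp, hq, hfpq⟩ := exists_monotone_sub f hV
    filter_upwards [ae_restrict_mem measurableSet_Icc, ae_restrict_of_ae hp.ae_continuousAt_pi,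
      ae_restrict_of_ae hq.ae_continuousAt_pi] with x hx hpx hqx
    choose c hc hxc heq hmin using fun m : ℕ => exists_gridSum_boxIndicator_eq
      (A ∪ (Finset.range (m + 1)).image (fun k : ℕ => (k : ℝ) / (m + 1))) f hx
    have hupper : ∀ (m : ℕ) (i : ι), c m i ≤ x i + 1 / ((m : ℝ) + 1) := by
      intro m i
      have hm : (0 : ℝ) < (m : ℝ) + 1 := by positivity
      have hx0 : 0 ≤ x i := hx.1 i
      have hx1 : x i ≤ 1 := hx.2 i
      -- `j / (m + 1)` is the smallest multiple of `1 / (m + 1)` that is at least `x i`.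
      set j := ⌈x i * (m + 1)⌉₊ with hj
      have hjm : j ≤ m + 1 := Nat.ceil_le.2 (by push_cast; nlinarith)
      have hjx : x i ≤ (j : ℝ) / (m + 1) := (le_div_iff₀ hm).2 (Nat.le_ceil _)
      have hjs : (j : ℝ) / (m + 1) ≤ x i + 1 / ((m : ℝ) + 1) := by
        rw [div_le_iff₀ hm, add_mul, one_div, inv_mul_cancel₀ hm.ne']
        exact (Nat.ceil_lt_add_one (by positivity)).le
      refine (hmin m i _ ?_ hjx).trans hjs
      rcases hjm.eq_or_lt with h | h
      · rw [h]; push_cast; rw [div_self hm.ne']; exact Finset.mem_insert_self _ _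
      · refine mem_insert_one_unitGrid (Finset.mem_union_right _
          (Finset.mem_image.2 ⟨j, Finset.mem_range.2 h, rfl⟩)) (by positivity) ?_
        rw [div_le_one hm]
        exact_mod_cast hjm
    have hcx : Filter.Tendsto c Filter.atTop (nhds x) := by
      refine tendsto_pi_nhds.2 fun i => ?_
      refine tendsto_of_tendsto_of_tendsto_of_le_of_le tendsto_const_nhds ?_
        (fun m => hxc m i) (fun m => hupper m i)
      simpa using tendsto_const_nhds.add (tendsto_one_div_add_atTop_nhds_zero_nat (𝕜 := ℝ))
    have hlim := (hpx.tendsto.comp hcx).sub (hqx.tendsto.comp hcx)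
    rw [hfpq x hx]
    refine hlim.congr fun m => ?_
    rw [heq m, hfpq _ (hc m)]
    rfl

/-! ### The star discrepancy and the Koksma-Hlawka inequality -/

lemma volume_Icc_zero_toReal {d : ℕ} {z : Fin d → ℝ} (hz : z ∈ unitCube d) :
    (volume (Set.Icc 0 z)).toReal = ∏ i, z i := by
  rw [Real.volume_Icc_pi_toReal hz.1]
  simp

lemma abs_localDiscrepancy_le_one {d N : ℕ} (y : Fin N → Fin d → ℝ) {z : Fin d → ℝ}
    (hz : z ∈ unitCube d) : |localDiscrepancy y (Set.Icc 0 z)| ≤ 1 := by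
  unfold localDiscrepancy
  rw [volume_Icc_zero_toReal hz]
  have h1 : ∏ i, z i ≤ 1 := Finset.prod_le_one (fun i _ => hz.1 i) (fun i _ => hz.2 i)
  have h0 : 0 ≤ ∏ i, z i := Finset.prod_nonneg fun i _ => hz.1 i
  have hcard : (Set.ncard {n : Fin N | y n ∈ Set.Icc 0 z} : ℝ) ≤ N := by
    have := Set.ncard_le_card {n : Fin N | y n ∈ Set.Icc 0 z}
    rw [Nat.card_fin] at this
    exact_mod_cast this
  have h2 : (Set.ncard {n : Fin N | y n ∈ Set.Icc 0 z} : ℝ) / N ≤ 1 :=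
    div_le_one_of_le₀ hcard (Nat.cast_nonneg _)
  have h3 : (0 : ℝ) ≤ (Set.ncard {n : Fin N | y n ∈ Set.Icc 0 z} : ℝ) / N := by positivity
  rw [abs_le]
  constructor <;> linarith

lemma abs_localDiscrepancy_le_starDiscrepancy {d N : ℕ} (y : Fin N → Fin d → ℝ) {z : Fin d → ℝ}
    (hz : z ∈ unitCube d) : |localDiscrepancy y (Set.Icc 0 z)| ≤ starDiscrepancy y := by
  refine le_csSup ⟨1, ?_⟩ ⟨_, ⟨z, hz, rfl⟩, rfl⟩
  rintro _ ⟨_, ⟨z, hz, rfl⟩, rfl⟩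
  exact abs_localDiscrepancy_le_one y hz

/-- In positive dimension the discrepancy cannot vanish: the fractions of points in boxes are
multiples of `1 / N`, while some box has volume `1 / (2 N)`. -/
lemma starDiscrepancy_pos {d N : ℕ} (hd : 0 < d) (hN : 0 < N) (y : Fin N → Fin d → ℝ) :
    0 < starDiscrepancy y := by
  have hN' : (1 : ℝ) ≤ N := by exact_mod_cast hN
  set z : Fin d → ℝ := Function.update 1 ⟨0, hd⟩ (1 / (2 * N)) with hzdef
  have hz : z ∈ unitCube d := by
    constructor
    · exact le_update_iff.2 ⟨by simp, fun _ _ => zero_le_one⟩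
    · refine update_le_iff.2 ⟨?_, fun _ _ => le_rfl⟩
      rw [Pi.one_apply, div_le_one (by positivity)]
      linarith
  refine lt_of_lt_of_le (abs_pos.2 fun h => ?_) (abs_localDiscrepancy_le_starDiscrepancy y hz)
  have hvol : ∏ i, z i = 1 / (2 * N) := by
    rw [hzdef, Finset.prod_update_of_mem (Finset.mem_univ _)]
    simp
  rw [localDiscrepancy, volume_Icc_zero_toReal hz, hvol, sub_eq_zero] at h
  field_simp at h
  have h' : Set.ncard {n : Fin N | y n ∈ Set.Icc 0 z} * 2 = 1 := by exact_mod_cast h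
  omega

lemma sum_boxIndicator_eq_ncard {d N : ℕ} (y : Fin N → Fin d → ℝ) (z : Fin d → ℝ) :
    ∑ n, boxIndicator (y n) z = (Set.ncard {n : Fin N | y n ∈ Set.Icc 0 z} : ℝ) := by
  classical
  rw [Set.ncard_eq_toFinset_card']
  simp [boxIndicator, Set.indicator_apply, Finset.sum_boole]

/-- The **Koksma-Hlawka inequality** for arbitrary functions of finite Hardy-Krause variation. -/
theorem abs_integral_sub_mean_le {d N : ℕ} (hN : 0 < N) {y : Fin N → Fin d → ℝ}
    (hy : ∀ n, y n ∈ unitCube d) (f : (Fin d → ℝ) → ℝ)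
    (hV : hardyKrauseVariation 0 1 f ≠ ∞) :
    |(∫ x in unitCube d, f x) - (1 / (N : ℝ)) * ∑ n, f (y n)| ≤
      starDiscrepancy y * (hardyKrauseVariation 0 1 f).toReal := by
  have hN' : (N : ℝ) ≠ 0 := by exact_mod_cast hN.ne'
  set A : Finset ℝ := ((Finset.univ : Finset (Fin N × Fin d))).image (fun p => y p.1 p.2)
  have hlim := tendsto_setIntegral_gridSum f hV A
  refine le_of_tendsto ((hlim.sub_const ((1 / (N : ℝ)) * ∑ n, f (y n))).abs)
    (Filter.Eventually.of_forall fun m => ?_)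
  set B := A ∪ (Finset.range (m + 1)).image (fun k : ℕ => (k : ℝ) / (m + 1))
  have hrep : ∀ n, f (y n) = gridSum (unitGrid B) f (boxIndicator (y n)) := fun n =>
    (gridSum_boxIndicator lt_one_of_mem_unitGrid f (hy n) fun i => mem_insert_one_unitGrid
      (Finset.mem_union_left _ (Finset.mem_image.2 ⟨(n, i), Finset.mem_univ _, rfl⟩))
      ((hy n).1 i) ((hy n).2 i)).symm
  have hdisc : (∫ x in Set.Icc (0 : Fin d → ℝ) 1, gridSum (unitGrid B) f (boxIndicator x)) -
      (1 / (N : ℝ)) * ∑ n, f (y n) =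
        - gridSum (unitGrid B) f (fun z => localDiscrepancy y (Set.Icc 0 z)) := by
    rw [Finset.sum_congr rfl fun n _ => hrep n, ← gridSum_sum, ← gridSum_const_mul,
      setIntegral_gridSum_boxIndicator, ← neg_sub, ← gridSum_sub]
    simp only [sum_boxIndicator_eq_ncard, localDiscrepancy, div_eq_inv_mul, mul_one]
  have key := sum_abs_gridSum_le B f hV ({()} : Finset Unit)
    (fun _ z => localDiscrepancy y (Set.Icc 0 z)) (B := starDiscrepancy y)
    (fun z hz => by simpa using abs_localDiscrepancy_le_starDiscrepancy y hz) fun _ => by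
      have hall : {n : Fin N | y n ∈ Set.Icc (0 : Fin d → ℝ) 1} = Set.univ :=
        Set.eq_univ_of_forall hy
      rw [localDiscrepancy, hall, volume_Icc_zero_toReal ⟨zero_le_one, le_rfl⟩]
      simp [Set.ncard_univ, hN']
  rw [hdisc, abs_neg]
  simpa using key

end

theorem lemma1 (d : ℕ) (C : ℝ) (L : (Fin d → ℝ) → ℝ)
    (N : ℕ) (hN : 0 < N) (y : Fin N → Fin d → ℝ) (hy : IsLowDiscrepancy C y)
    (σ : ℝ → ℝ) (K : ℕ) (hK : 1 < K) (θ : NetworkParams K d 1) :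
    ENNReal.ofReal
        |generalizationError L (neuralNetwork σ θ) - trainingError y L (neuralNetwork σ θ)| ≤
      ENNReal.ofReal C *
        hardyKrauseVariation (0 : Fin d → ℝ) 1 (fun x => |L x - neuralNetwork σ θ x|) *
        ENNReal.ofReal ((Real.log (N : ℝ)) ^ d / (N : ℝ)) := by
  obtain ⟨hcube, hdisc⟩ := hy
  set f : (Fin d → ℝ) → ℝ := fun x => |L x - neuralNetwork σ θ x| with hf
  have hlog : 0 ≤ (Real.log (N : ℝ)) ^ d / (N : ℝ) :=
    div_nonneg (pow_nonneg (Real.log_natCast_nonneg N) d) (Nat.cast_nonneg N)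
  rw [mul_div_assoc] at hdisc
  rw [mul_right_comm, ← ENNReal.ofReal_mul' hlog]
  by_cases hV : hardyKrauseVariation (0 : Fin d → ℝ) 1 f = ∞
  · rcases Nat.eq_zero_or_pos d with rfl | hd
    · -- In dimension `0` there are no proper subsets of the coordinates, so the variation is `0`.
      exfalso
      simp [hardyKrauseVariation] at hV
    · -- The bound is not lost to `0 * ∞`: a positive discrepancy makes the constant positive.
      have hpos := (starDiscrepancy_pos hd hN y).trans_le hdisc
      rw [hV, ENNReal.mul_top (ENNReal.ofReal_pos.2 hpos).ne']
      exact le_top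
  · have key := abs_integral_sub_mean_le hN hcube f hV
    calc ENNReal.ofReal
          |generalizationError L (neuralNetwork σ θ) - trainingError y L (neuralNetwork σ θ)|
        ≤ ENNReal.ofReal (C * ((Real.log (N : ℝ)) ^ d / (N : ℝ)) *
            (hardyKrauseVariation 0 1 f).toReal) :=
          ENNReal.ofReal_le_ofReal
            (key.trans (mul_le_mul_of_nonneg_right hdisc ENNReal.toReal_nonneg))
      _ = ENNReal.ofReal (C * ((Real.log (N : ℝ)) ^ d / (N : ℝ))) *
            hardyKrauseVariation 0 1 f := by
          rw [ENNReal.ofReal_mul' ENNReal.toReal_nonneg, ENNReal.ofReal_toReal hV]
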